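/- Let $\mathbb{D}$ be the open unit disc in $\mathbb{C}$, and write $\partial_z=\frac12(\partial_x-i\partial_y)$, $\partial_{\bar z}=\frac12(\partial_x+i\partial_y)$. For $\alpha,\beta\in\mathbb{R}$, a function $u:\mathbb{D}\to\mathbb{C}$ is called $(\alpha,\beta)$-harmonic if it is twice continuously differentiable in $\mathbb{D}$ and $$(1-|z|^2)\Big((1-|z|^2)\,\partial_z\partial_{\bar z}u+\alpha z\,\partial_z u+\beta\bar z\,\partial_{\bar z}u-\alpha\beta\,u\Big)=0\quad\text{in }\mathbb{D}.$$ Let $H_G^1(\mathbb{D})$ be the set of all measurable functions $g:\mathbb{D}\to\mathbb{C}$ such that the integral mean $M_1(r,g)=\frac1{2\pi}\int_0^{2\pi}|g(re^{i\theta})|\,d\theta$ exists for every $r\in(0,1)$ and $\sup_{0<r<1}M_1(r,g)<\infty$. **Theorem.** Let $\alpha,\beta$ be nonzero real numbers, neither of which is a negative integer, such that $\alpha+\beta=0$, and let $u$ be an $(\alpha,\beta)$-harmonic function. If $\partial_z u\in H_G^1(\mathbb{D})$ or $\partial_{\bar z}u\in H_G^1(\mathbb{D})$, then $u(z)=0$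 for all $z\in\mathbb{D}$. -/

import Mathlib

open MeasureTheory Metric Set
open scoped ENNReal

noncomputable section

/-- The Wirtinger derivative `∂_z f = (∂_x f - i ∂_y f) / 2` of a function of `z = x + i y`. -/
def wirtingerDz (f : ℂ → ℂ) (z : ℂ) : ℂ :=
  (fderiv ℝ f z 1 - Complex.I * fderiv ℝ f z Complex.I) / 2

/-- The Wirtinger derivative `∂_{z̄} f = (∂_x f + i ∂_y f) / 2` of a function of `z = x + i y`. -/
def wirtingerDzbar (f : ℂ → ℂ) (z : ℂ) : ℂ :=
  (fderiv ℝ f z 1 + Complex.I * fderiv ℝ f z Complex.I) / 2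

/-- The operator
`Δ_{α,β} = (1 - |z|²) ((1 - |z|²) ∂_z ∂_{z̄} + α z ∂_z + β z̄ ∂_{z̄} - α β)`. -/
def weightedLaplacian (α β : ℝ) (u : ℂ → ℂ) (z : ℂ) : ℂ :=
  (1 - (‖z‖ : ℂ) ^ 2) *
    ((1 - (‖z‖ : ℂ) ^ 2) * wirtingerDz (wirtingerDzbar u) z
      + (α : ℂ) * z * wirtingerDz u z
      + (β : ℂ) * (starRingEnd ℂ) z * wirtingerDzbar u z
      - (α : ℂ) * (β : ℂ) * u z)

/-- `u` is `(α, β)`-harmonic: twice continuously (real) differentiable in the open unit disc with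
`Δ_{α,β} u = 0` there. Values of `u` outside the disc play no role. -/
def IsAlphaBetaHarmonic (α β : ℝ) (u : ℂ → ℂ) : Prop :=
  ContDiffOn ℝ 2 u (ball (0 : ℂ) 1) ∧ ∀ z ∈ ball (0 : ℂ) 1, weightedLaplacian α β u z = 0

/-- The integral mean `M_p(r, f) = ((1 / 2π) ∫_0^{2π} |f(r e^{iθ})|^p dθ)^{1/p}`, for `0 < p < ∞`,
as an element of `[0, ∞]`. -/
def hardyMean (p r : ℝ) (f : ℂ → ℂ) : ℝ≥0∞ :=
  ((ENNReal.ofReal (2 * Real.pi))⁻¹ *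
    ∫⁻ θ in Ioc 0 (2 * Real.pi), ‖f (circleMap 0 r θ)‖ₑ ^ p) ^ (1 / p)

/-- `‖f‖_p`: the supremum of `M_p(r, f)` over `0 < r < 1` if `0 < p < ∞`, and the supremum of `|f|`
over the unit disc if `p = ∞`. -/
def hardyNorm (p : ℝ≥0∞) (f : ℂ → ℂ) : ℝ≥0∞ :=
  if p = ∞ then ⨆ z ∈ ball (0 : ℂ) 1, ‖f z‖ₑ
  else ⨆ r ∈ Ioo (0 : ℝ) 1, hardyMean p.toReal r f

/-- Membership in the generalized Hardy space `H_G^p(𝔻)`, `p ∈ (0, ∞]`: `f` is (Lebesgue) measurable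
on the unit disc, for `p < ∞` the integrals defining `M_p(r, f)`, `0 < r < 1`, make sense (the
integrand is measurable), and `‖f‖_p < ∞`. -/
def MemGeneralizedHardy (p : ℝ≥0∞) (f : ℂ → ℂ) : Prop :=
  0 < p ∧ AEMeasurable f (volume.restrict (ball (0 : ℂ) 1)) ∧
    (p ≠ ∞ → ∀ r ∈ Ioo (0 : ℝ) 1,
      AEMeasurable (fun θ : ℝ => ‖f (circleMap 0 r θ)‖ₑ ^ p.toReal)
        (volume.restrict (Ioc 0 (2 * Real.pi)))) ∧
    hardyNorm p f < ∞

end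

/-! Fix `k` and let `g`, `b` be the `k`-th Fourier coefficients of `u` and `z̄ ∂_{z̄} u` on the
circle of radius `r`. As `β = -α`, the equation becomes `r g' = 2b + k g`, `r b' = -k b - 2α(α+k)
r²/(1-r²) g`, and `α` is not an integer. The Hardy hypothesis bounds `b` or `b + k g`, so `g` has a
limit at `1`. A nonzero limit would make `b` diverge logarithmically, so `g(1) = 0`
(`radial_eq_zero_of_bounded`). Integrating the system against powers of `r` then gives a two-term
recursion for the moments of `g`. It starts at zero and never degenerates, because `α` is not an
integer. Hence `g = 0` by Weierstrass approximation (`radial_eq_zero_of_boundary_zero`), and `u = 0`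
by uniqueness of Fourier coefficients. -/

open Filter Topology

/-! ### Boundary behaviour at `r = 1` in one variable -/

/-- A function with bounded derivative near the right end of `(0, 1)` has a limit at `1`. -/
theorem exists_tendsto_one_of_bounded_deriv {P p : ℝ → ℝ} {C : ℝ}
    (hP : ∀ r ∈ Ioo (0 : ℝ) 1, HasDerivAt P (p r) r)
    (hp : ∀ r ∈ Ico (1 / 2 : ℝ) 1, |p r| ≤ C) : ∃ L, Tendsto P (𝓝[<] 1) (𝓝 L) := by
  have hlip : LipschitzOnWith C.toNNReal P (Ico (1 / 2 : ℝ) 1) := by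
    refine (convex_Ico _ _).lipschitzOnWith_of_nnnorm_hasDerivWithin_le (f' := p)
      (fun r hr => (hP r ⟨by linarith [hr.1], hr.2⟩).hasDerivWithinAt) fun r hr => ?_
    rw [← NNReal.coe_le_coe, coe_nnnorm, Real.norm_eq_abs]
    exact (hp r hr).trans (Real.le_coe_toNNReal C)
  obtain ⟨F, hF, hPF⟩ := hlip.extend_real
  refine ⟨F 1, ((hF.continuous.tendsto 1).mono_left nhdsWithin_le_nhds).congr' ?_⟩
  filter_upwards [Ico_mem_nhdsLT (by norm_num : (1 / 2 : ℝ) < 1)] with r hr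
  exact (hPF hr).symm

/-- The integrating factor `r ^ (-j)` removes the term in `g`; what remains of the derivative is
bounded on `[1/2, 1)`. -/
theorem exists_tendsto_one_of_euler {g q : ℝ → ℝ} {C : ℝ} (j : ℤ)
    (hg : ∀ r ∈ Ioo (0 : ℝ) 1, HasDerivAt g ((2 * q r + j * g r) / r) r)
    (hq : ∀ r ∈ Ioo (0 : ℝ) 1, |q r| ≤ C) : ∃ L, Tendsto g (𝓝[<] 1) (𝓝 L) := by
  have hP : ∀ r ∈ Ioo (0 : ℝ) 1,
      HasDerivAt (fun r => r ^ (-j) * g r) (2 * (r ^ (-j) / r) * q r) r := by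
    intro r hr
    have hr0 : r ≠ 0 := hr.1.ne'
    refine ((hasDerivAt_zpow (-j) r (Or.inl hr0)).mul (hg r hr)).congr_deriv ?_
    rw [zpow_sub_one₀ hr0]
    push_cast
    field_simp
    ring
  have hcont : ContinuousOn (fun r : ℝ => r ^ (-j) / r) (Icc (1 / 2) 1) := by
    intro r hr
    have hr0 : r ≠ 0 := by linarith [hr.1]
    exact ((continuousAt_zpow₀ r _ (Or.inl hr0)).div continuousAt_id hr0).continuousWithinAt
  obtain ⟨K, hK⟩ := isCompact_Icc.exists_bound_of_continuousOn hcont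
  obtain ⟨L, hL⟩ := exists_tendsto_one_of_bounded_deriv (C := 2 * K * C) hP (by
    intro r hr
    have h1 := hK r ⟨hr.1, hr.2.le⟩
    have h2 := hq r ⟨by linarith [hr.1], hr.2⟩
    rw [Real.norm_eq_abs] at h1
    rw [abs_mul, abs_mul, abs_two]
    have := (abs_nonneg _).trans h1
    gcongr)
  refine ⟨L, ?_⟩
  have hz : Tendsto (fun r : ℝ => r ^ j) (𝓝[<] 1) (𝓝 1) := by
    have := (continuousAt_zpow₀ (1 : ℝ) j (Or.inl one_ne_zero)).tendsto
    rw [one_zpow] at this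
    exact this.mono_left nhdsWithin_le_nhds
  have := hz.mul hL
  rw [one_mul] at this
  refine this.congr' ?_
  filter_upwards [Ioo_mem_nhdsLT (zero_lt_one' ℝ)] with r hr
  rw [← mul_assoc, ← zpow_add₀ hr.1.ne']
  simp

/-- If `D > 0`, then `Q' ≥ (D/2)/(1-r)` near `1`, so `Q` grows at least like `-(D/2) log (1-r)`,
which is unbounded. -/
theorem nonpos_of_log_deriv {Q q : ℝ → ℝ} {C D : ℝ}
    (hQ : ∀ r ∈ Ioo (0 : ℝ) 1, HasDerivAt Q (q r) r)
    (hlim : Tendsto (fun r => (1 - r) * q r) (𝓝[<] 1) (𝓝 D))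
    (hbd : ∀ᶠ r in 𝓝[<] 1, |Q r| ≤ C) : D ≤ 0 := by
  by_contra! hD
  have h1 : ∀ᶠ r in 𝓝[<] (1 : ℝ), D / 2 < (1 - r) * q r := hlim.eventually_const_lt (by linarith)
  obtain ⟨ρ, hρ, hsub⟩ := mem_nhdsLT_iff_exists_Ico_subset.1
    (h1.and (Ioo_mem_nhdsLT (zero_lt_one' ℝ)))
  have hρ1 : ρ < 1 := hρ
  have hmono : MonotoneOn (fun r => Q r + D / 2 * Real.log (1 - r)) (Ico ρ 1) := by
    have hder : ∀ r ∈ Ico ρ 1, HasDerivAt (fun r => Q r + D / 2 * Real.log (1 - r))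
        (q r + D / 2 * (-1 / (1 - r))) r := by
      intro r hr
      have h1r : 1 - r ≠ 0 := by linarith [hr.2]
      exact (hQ r (hsub hr).2).add
        ((((hasDerivAt_id r).const_sub 1).log h1r).const_mul _)
    refine monotoneOn_of_deriv_nonneg (convex_Ico _ _)
      (fun r hr => (hder r hr).continuousAt.continuousWithinAt)
      (fun r hr => (hder r (interior_subset hr)).differentiableAt.differentiableWithinAt) ?_
    intro r hr
    have hr' := interior_subset hr
    rw [(hder r hr').deriv]
    have h1r : 0 < 1 - r := by linarith [hr'.2]
    have h2 := (hsub hr').1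
    have : q r + D / 2 * (-1 / (1 - r)) = ((1 - r) * q r - D / 2) / (1 - r) := by
      field_simp
      ring
    rw [this]
    exact div_nonneg (by linarith) h1r.le
  have hlog : Tendsto (fun r : ℝ => Real.log (1 - r)) (𝓝[<] 1) atBot := by
    refine Real.tendsto_log_nhdsGT_zero.comp ?_
    refine tendsto_nhdsWithin_of_tendsto_nhds_of_eventually_within _ ?_ ?_
    · have : Tendsto (fun r : ℝ => 1 - r) (𝓝 1) (𝓝 (1 - 1)) := tendsto_const_nhds.sub tendsto_id
      rw [sub_self] at this
      exact this.mono_left nhdsWithin_le_nhds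
    · filter_upwards [self_mem_nhdsWithin] with r hr
      exact sub_pos.2 (mem_Iio.1 hr)
  have hlog' := (tendsto_atBot.1 hlog)
    ((Q ρ + D / 2 * Real.log (1 - ρ) - C - 1) / (D / 2))
  obtain ⟨r, ⟨hr1, hr2⟩, hr3⟩ := ((hlog'.and hbd).and (Ico_mem_nhdsLT hρ1)).exists
  have h3 := hmono ⟨le_rfl, hρ1⟩ hr3 hr3.1
  rw [le_div_iff₀ (by linarith)] at hr1
  have := (le_abs_self _).trans hr2
  simp only at h3
  linarith

theorem eq_zero_of_log_deriv {Q q : ℝ → ℝ} {C D : ℝ}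
    (hQ : ∀ r ∈ Ioo (0 : ℝ) 1, HasDerivAt Q (q r) r)
    (hlim : Tendsto (fun r => (1 - r) * q r) (𝓝[<] 1) (𝓝 D))
    (hbd : ∀ᶠ r in 𝓝[<] 1, |Q r| ≤ C) : D = 0 := by
  refine le_antisymm (nonpos_of_log_deriv hQ hlim hbd) ?_
  have := nonpos_of_log_deriv (Q := fun r => -Q r) (q := fun r => -q r) (C := C) (D := -D)
    (fun r hr => (hQ r hr).neg) (by simpa using hlim.neg) (by simpa using hbd)
  linarith

/-! ### Moments and the radial system -/

/-- A continuous function on `[0, 1]` all of whose even moments vanish is zero. -/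
theorem eq_zero_of_even_moments {h : ℝ → ℝ} (hc : ContinuousOn h (Icc 0 1))
    (hm : ∀ n : ℕ, ∫ r in (0 : ℝ)..1, r ^ (2 * n) * h r = 0) : ∀ r ∈ Icc (0 : ℝ) 1, h r = 0 := by
  have hu : uIcc (0 : ℝ) 1 = Icc 0 1 := uIcc_of_le zero_le_one
  have hpoly : ∀ p : Polynomial ℝ, ∫ r in (0 : ℝ)..1, p.eval (r ^ 2) * h r = 0 := by
    intro p
    simp_rw [Polynomial.eval_eq_sum_range, Finset.sum_mul]
    rw [intervalIntegral.integral_finsetSum]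
    · refine Finset.sum_eq_zero fun i _ => ?_
      simp_rw [mul_assoc, ← pow_mul]
      rw [intervalIntegral.integral_const_mul, hm, mul_zero]
    · intro i _
      apply ContinuousOn.intervalIntegrable
      rw [hu]
      fun_prop
  obtain ⟨K, hK⟩ := isCompact_Icc.exists_bound_of_continuousOn hc
  have hK0 : 0 ≤ K := (norm_nonneg _).trans (hK 0 ⟨le_rfl, zero_le_one⟩)
  have hsq : ∫ r in (0 : ℝ)..1, h r * h r ≤ 0 := by
    refine le_of_forall_pos_le_add fun ε hε => ?_
    -- Approximating `h ∘ √` by `p` makes `p (r²)`, which has even powers only, uniformly close to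
    -- `h r`.
    have hcs : ContinuousOn (fun x => h (√x)) (Icc 0 1) :=
      hc.comp Real.continuous_sqrt.continuousOn fun x hx =>
        ⟨Real.sqrt_nonneg x, Real.sqrt_le_one.2 hx.2⟩
    obtain ⟨p, hp⟩ := exists_polynomial_near_of_continuousOn 0 1 _ hcs (ε / (K + 1)) (by positivity)
    have hbound : ∀ r ∈ Icc (0 : ℝ) 1, h r * h r ≤ p.eval (r ^ 2) * h r + ε := by
      intro r hr
      have h1 := hp (r ^ 2) ⟨by positivity, pow_le_one₀ hr.1 hr.2⟩
      rw [Real.sqrt_sq hr.1, abs_sub_comm] at h1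
      have h2 := hK r hr
      rw [Real.norm_eq_abs] at h2
      have h3 : (h r - p.eval (r ^ 2)) * h r ≤ ε := by
        calc _ ≤ |(h r - p.eval (r ^ 2)) * h r| := le_abs_self _
          _ = |h r - p.eval (r ^ 2)| * |h r| := abs_mul _ _
          _ ≤ ε / (K + 1) * (K + 1) := by gcongr; linarith
          _ = ε := by field_simp
      linarith
    have hpc : ContinuousOn (fun r => p.eval (r ^ 2) * h r) (Icc 0 1) :=
      (p.continuous.comp (continuous_pow 2)).continuousOn.mul hc
    have := intervalIntegral.integral_mono_on (μ := volume) zero_le_one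
      (ContinuousOn.intervalIntegrable (by rw [hu]; exact hc.mul hc))
      (ContinuousOn.intervalIntegrable (by rw [hu]; exact hpc.add continuousOn_const)) hbound
    rw [intervalIntegral.integral_add
      (ContinuousOn.intervalIntegrable (by rw [hu]; exact hpc)) (by simp), hpoly] at this
    simpa using this
  by_contra! hne
  obtain ⟨r, hr, hr0⟩ := hne
  have := intervalIntegral.integral_pos (f := fun r => h r * h r) zero_lt_one (hc.mul hc)
    (fun x _ => mul_self_nonneg (h x)) ⟨r, hr, mul_self_pos.2 hr0⟩
  linarith

/-- The radial system of an angular mode: a solution that is continuous on `[0, 1]` and vanishes at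
the boundary has vanishing moments, hence is zero. -/
theorem radial_eq_zero_of_boundary_zero {k : ℤ} {α : ℝ} (hα : ∀ n : ℤ, α ≠ n) {g b : ℝ → ℝ} {C : ℝ}
    (hg : ∀ r ∈ Ioo (0 : ℝ) 1, HasDerivAt g ((2 * b r + k * g r) / r) r)
    (hb : ∀ r ∈ Ioo (0 : ℝ) 1,
      HasDerivAt b ((-k * b r) / r - 2 * (α * (α + k)) * r / (1 - r ^ 2) * g r) r)
    (hgc : ContinuousOn g (Icc 0 1)) (hg1 : g 1 = 0) (hb0 : Tendsto b (𝓝[>] 0) (𝓝 0))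
    (hb1 : ∀ᶠ r in 𝓝[<] 1, |b r| ≤ C) : ∀ r ∈ Ioo (0 : ℝ) 1, g r = 0 := by
  have hu : uIcc (0 : ℝ) 1 = Icc 0 1 := uIcc_of_le zero_le_one
  have hgt0 : Tendsto g (𝓝[>] 0) (𝓝 (g 0)) :=
    (hgc 0 ⟨le_rfl, zero_le_one⟩).tendsto.mono_left
      (nhdsWithin_le_of_mem (Icc_mem_nhdsGT zero_lt_one))
  have hgt1 : Tendsto g (𝓝[<] 1) (𝓝 0) := by
    have := (hgc 1 ⟨zero_le_one, le_rfl⟩).tendsto.mono_left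
      (nhdsWithin_le_of_mem (Icc_mem_nhdsLT zero_lt_one))
    rwa [hg1] at this
  set M : ℕ → ℝ := fun m => ∫ r in (0 : ℝ)..1, r ^ m * g r with hM
  have hint : ∀ m : ℕ, IntervalIntegrable (fun r => r ^ m * g r) volume 0 1 := fun m =>
    ContinuousOn.intervalIntegrable (by rw [hu]; exact (continuous_pow m).continuousOn.mul hgc)
  -- The coefficient of `g` in `E m` is chosen so that `b` cancels from the derivative, leaving only
  -- multiples of `r^(m-1) g` and `r^(m+1) g`.
  set E : ℕ → ℝ → ℝ := fun m r =>
    r ^ m * ((1 - r ^ 2) * (b r + k / 2 * g r) - (m / 2 - (m / 2 + 1) * r ^ 2) * g r) with hE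
  have hEd : ∀ m : ℕ, ∀ r ∈ Ioo (0 : ℝ) 1, HasDerivAt (E m)
      ((k ^ 2 - m ^ 2) / 2 * (r ^ m / r * g r)
        + 2 * ((m / 2 + 1) ^ 2 - (k / 2 + α) ^ 2) * (r ^ (m + 1) * g r)) r := by
    intro m r hr
    have hr0 : r ≠ 0 := hr.1.ne'
    have hr1 : 1 - r ^ 2 ≠ 0 := by nlinarith [hr.1, hr.2]
    have hpow : HasDerivAt (fun r : ℝ => r ^ m) (m * (r ^ m / r)) r := by
      refine (hasDerivAt_pow m r).congr_deriv ?_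
      rcases m with _ | m
      · simp
      · rw [pow_succ, Nat.add_sub_cancel]
        field_simp
    have hsq : HasDerivAt (fun r : ℝ => r ^ 2) (2 * r) r := by simpa using hasDerivAt_pow 2 r
    refine (hpow.mul (((hsq.const_sub 1).mul ((hb r hr).add ((hg r hr).const_mul (k / 2 : ℝ)))).sub
      (((hsq.const_mul (m / 2 + 1 : ℝ)).const_sub (m / 2 : ℝ)).mul (hg r hr)))).congr_deriv ?_
    simp only [Pi.add_apply, Pi.sub_apply, Pi.mul_apply]
    field_simp
    ring
  have hE0 : ∀ n : ℕ, Tendsto (E (k.natAbs + 2 * n)) (𝓝[>] 0) (𝓝 0) := by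
    intro n
    have hid : Tendsto (fun r : ℝ => r) (𝓝[>] 0) (𝓝 0) := tendsto_id.mono_left nhdsWithin_le_nhds
    have := (hid.pow (k.natAbs + 2 * n)).mul
      ((((hid.pow 2).const_sub 1).mul (hb0.add (hgt0.const_mul (k / 2 : ℝ)))).sub
      ((((hid.pow 2).const_mul (((k.natAbs + 2 * n : ℕ) : ℝ) / 2 + 1)).const_sub
        (((k.natAbs + 2 * n : ℕ) : ℝ) / 2)).mul hgt0))
    convert this using 2
    -- The factor `r ^ m` vanishes at `0` unless `m = 0`; then `k = 0` too, and the bracket tends to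
    -- the limit of `b`, which is `0`.
    rcases Nat.eq_zero_or_pos (k.natAbs + 2 * n) with h | h
    · have hk : k = 0 := by omega
      rw [h, hk]
      simp
    · rw [zero_pow h.ne', zero_mul]
  have hE1 : ∀ m : ℕ, Tendsto (E m) (𝓝[<] 1) (𝓝 0) := by
    intro m
    have hid : Tendsto (fun r : ℝ => r) (𝓝[<] 1) (𝓝 1) := tendsto_id.mono_left nhdsWithin_le_nhds
    have h1 : Tendsto (fun r : ℝ => 1 - r ^ 2) (𝓝[<] 1) (𝓝 0) := by
      simpa using (hid.pow 2).const_sub 1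
    have h2 : Tendsto (fun r : ℝ => (1 - r ^ 2) * b r) (𝓝[<] 1) (𝓝 0) := by
      refine squeeze_zero_norm' (a := fun r => |1 - r ^ 2| * C) ?_ (by simpa using h1.abs.mul_const C)
      filter_upwards [hb1] with r hr
      rw [Real.norm_eq_abs, abs_mul]
      gcongr
    have := (hid.pow m).mul ((h2.add (h1.mul (hgt1.const_mul (k / 2 : ℝ)))).sub
      ((((hid.pow 2).const_mul ((m : ℝ) / 2 + 1)).const_sub ((m : ℝ) / 2)).mul hgt1))
    simp only [mul_zero, add_zero, sub_zero] at this
    refine this.congr fun r => ?_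
    simp only [hE]
    ring
  -- Since `|k|` and `k` have the same parity, a zero of either linear factor would make `α` an
  -- integer.
  have hne : ∀ n : ℕ,
      2 * ((((k.natAbs + 2 * n : ℕ) : ℝ) / 2 + 1) ^ 2 - ((k : ℝ) / 2 + α) ^ 2) ≠ 0 := by
    intro n h
    have h' : ((((k.natAbs + 2 * n : ℕ) : ℝ) / 2 + 1) - ((k : ℝ) / 2 + α))
        * ((((k.natAbs + 2 * n : ℕ) : ℝ) / 2 + 1) + ((k : ℝ) / 2 + α)) = 0 := by linarith
    have hcast : (((k.natAbs + 2 * n : ℕ) : ℝ)) = ((|k| + 2 * n : ℤ) : ℝ) := by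
      push_cast
      rw [Nat.cast_natAbs]
      push_cast
      rfl
    rw [hcast] at h'
    have habs : ∃ j : ℤ, |k| = k + 2 * j := by
      rcases abs_choice k with h | h
      · exact ⟨0, by omega⟩
      · exact ⟨-k, by omega⟩
    obtain ⟨j, hj⟩ := habs
    rw [hj] at h'
    push_cast at h'
    rcases mul_eq_zero.1 h' with h | h
    · exact hα (j + n + 1) (by push_cast; linarith)
    · exact hα (-(k + j + n + 1)) (by push_cast; linarith)
  -- For `m = |k|` the coefficient `k² - m²` kills the lower moment, which starts the recursion.
  have hmom : ∀ n : ℕ, M (k.natAbs + 2 * n + 1) = 0 := by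
    intro n
    induction n with
    | zero =>
      have h0 : ∀ r ∈ Ioo (0 : ℝ) 1, HasDerivAt (E (k.natAbs + 2 * 0))
          (2 * ((((k.natAbs + 2 * 0 : ℕ) : ℝ) / 2 + 1) ^ 2 - ((k : ℝ) / 2 + α) ^ 2)
            * (r ^ (k.natAbs + 2 * 0 + 1) * g r)) r := by
        intro r hr
        refine (hEd _ r hr).congr_deriv ?_
        have : (k : ℝ) ^ 2 - ((k.natAbs + 2 * 0 : ℕ) : ℝ) ^ 2 = 0 := by
          rw [mul_zero, add_zero, Nat.cast_natAbs, Int.cast_abs, sq_abs, sub_self]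
        rw [this]
        ring
      have := intervalIntegral.integral_eq_sub_of_hasDerivAt_of_tendsto zero_lt_one h0
        ((hint _).const_mul _) (hE0 0) (hE1 _)
      rw [intervalIntegral.integral_const_mul, sub_zero] at this
      exact (mul_eq_zero.1 this).resolve_left (hne 0)
    | succ n ih =>
      have h0 : ∀ r ∈ Ioo (0 : ℝ) 1, HasDerivAt (E (k.natAbs + 2 * (n + 1)))
          (((k : ℝ) ^ 2 - ((k.natAbs + 2 * (n + 1) : ℕ) : ℝ) ^ 2) / 2
            * (r ^ (k.natAbs + 2 * n + 1) * g r)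
          + 2 * ((((k.natAbs + 2 * (n + 1) : ℕ) : ℝ) / 2 + 1) ^ 2 - ((k : ℝ) / 2 + α) ^ 2)
            * (r ^ (k.natAbs + 2 * (n + 1) + 1) * g r)) r := by
        intro r hr
        refine (hEd _ r hr).congr_deriv ?_
        have hr0 : r ≠ 0 := hr.1.ne'
        have : r ^ (k.natAbs + 2 * (n + 1)) / r = r ^ (k.natAbs + 2 * n + 1) := by
          rw [show k.natAbs + 2 * (n + 1) = k.natAbs + 2 * n + 1 + 1 by ring, pow_succ _ (_ + 1)]
          field_simp
        rw [this]
      have := intervalIntegral.integral_eq_sub_of_hasDerivAt_of_tendsto zero_lt_one h0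
        (((hint _).const_mul _).add ((hint _).const_mul _)) (hE0 (n + 1)) (hE1 _)
      rw [intervalIntegral.integral_add ((hint _).const_mul _) ((hint _).const_mul _),
        intervalIntegral.integral_const_mul, intervalIntegral.integral_const_mul] at this
      simp only [hM] at ih
      rw [ih, mul_zero, zero_add, sub_zero] at this
      exact (mul_eq_zero.1 this).resolve_left (hne (n + 1))
  have hzero := eq_zero_of_even_moments (h := fun r => r ^ (k.natAbs + 1) * g r)
    ((continuous_pow _).continuousOn.mul hgc) (by
      intro n
      have := hmom n
      simp only [hM] at this
      simp_rw [← mul_assoc, ← pow_add, show ∀ n, 2 * n + (k.natAbs + 1) = k.natAbs + 2 * n + 1 by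
        intro n; ring]
      exact this)
  intro r hr
  exact (mul_eq_zero.1 (hzero r ⟨hr.1.le, hr.2.le⟩)).resolve_left (pow_ne_zero _ hr.1.ne')

/-- Either bound gives `g` a limit `L` at `1` and keeps `b` bounded there. As `(1-r) b'` tends to
`-α(α+k) L` up to a harmless power of `r`, boundedness forces `L = 0`. -/
theorem radial_eq_zero_of_bounded {k : ℤ} {α : ℝ} (hα : ∀ n : ℤ, α ≠ n) {g b : ℝ → ℝ} {C g₀ : ℝ}
    (hg : ∀ r ∈ Ioo (0 : ℝ) 1, HasDerivAt g ((2 * b r + k * g r) / r) r)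
    (hb : ∀ r ∈ Ioo (0 : ℝ) 1,
      HasDerivAt b ((-k * b r) / r - 2 * (α * (α + k)) * r / (1 - r ^ 2) * g r) r)
    (hg0 : Tendsto g (𝓝[>] 0) (𝓝 g₀)) (hb0 : Tendsto b (𝓝[>] 0) (𝓝 0))
    (hbd : (∀ r ∈ Ioo (0 : ℝ) 1, |b r + k * g r| ≤ C) ∨ ∀ r ∈ Ioo (0 : ℝ) 1, |b r| ≤ C) :
    ∀ r ∈ Ioo (0 : ℝ) 1, g r = 0 := by
  have hmem : Ioo (0 : ℝ) 1 ∈ 𝓝[<] (1 : ℝ) := Ioo_mem_nhdsLT zero_lt_one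
  obtain ⟨L, hL, C', hb1⟩ : ∃ L, Tendsto g (𝓝[<] 1) (𝓝 L) ∧ ∃ C', ∀ᶠ r in 𝓝[<] 1, |b r| ≤ C' := by
    rcases hbd with h | h
    -- In terms of `q = b + k g` the first equation reads `r g' = 2q - k g`.
    · obtain ⟨L, hL⟩ := exists_tendsto_one_of_euler (q := fun r => b r + k * g r) (-k)
        (fun r hr => (hg r hr).congr_deriv (by push_cast; ring)) h
      refine ⟨L, hL, C + |(k : ℝ)| * (|L| + 1), ?_⟩
      filter_upwards [hmem, hL.abs.eventually_le_const (lt_add_one |L|)] with r hr hr'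
      calc |b r| = |(b r + k * g r) - k * g r| := by ring_nf
        _ ≤ |b r + k * g r| + |k * g r| := abs_sub _ _
        _ ≤ C + |(k : ℝ)| * (|L| + 1) := by
          rw [abs_mul]
          have := h r hr
          gcongr
    · obtain ⟨L, hL⟩ := exists_tendsto_one_of_euler k hg h
      exact ⟨L, hL, C, by filter_upwards [hmem] with r hr using h r hr⟩
  have hz : ∀ j : ℤ, Tendsto (fun r : ℝ => r ^ j) (𝓝[<] 1) (𝓝 1) := by
    intro j
    have := (continuousAt_zpow₀ (1 : ℝ) j (Or.inl one_ne_zero)).tendsto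
    rw [one_zpow] at this
    exact this.mono_left nhdsWithin_le_nhds
  have hL0 : L = 0 := by
    have hid : Tendsto (fun r : ℝ => r) (𝓝[<] 1) (𝓝 1) := tendsto_id.mono_left nhdsWithin_le_nhds
    have hQ : ∀ r ∈ Ioo (0 : ℝ) 1, HasDerivAt (fun r => r ^ k * b r)
        (r ^ k * (-2 * (α * (α + k)) * r / (1 - r ^ 2) * g r)) r := by
      intro r hr
      have hr0 : r ≠ 0 := hr.1.ne'
      have hr1 : 1 - r ^ 2 ≠ 0 := by nlinarith [hr.1, hr.2]
      refine ((hasDerivAt_zpow k r (Or.inl hr0)).mul (hb r hr)).congr_deriv ?_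
      rw [zpow_sub_one₀ hr0]
      field_simp
      ring
    have hlim : Tendsto (fun r => (1 - r) * (r ^ k * (-2 * (α * (α + k)) * r / (1 - r ^ 2) * g r)))
        (𝓝[<] 1) (𝓝 (1 * (-2 * (α * (α + k)) * 1 / (1 + 1) * L))) := by
      refine ((hz k).mul (((hid.const_mul _).div (hid.const_add 1) (by norm_num)).mul hL)).congr' ?_
      filter_upwards [hmem] with r hr
      have hr1 : 1 - r ^ 2 ≠ 0 := by nlinarith [hr.1, hr.2]
      have hr2 : 1 + r ≠ 0 := by linarith [hr.1]
      simp only [Pi.div_apply]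
      field_simp
      ring
    -- The factor `2` absorbs `r ^ k`, which tends to `1`.
    have h0 := eq_zero_of_log_deriv (C := 2 * C') hQ hlim (by
      filter_upwards [hb1, (hz k).abs.eventually_le_const
        (show |(1 : ℝ)| < 2 by norm_num)] with r hr hr'
      rw [abs_mul]
      gcongr)
    have hα0 : α ≠ 0 := by simpa using hα 0
    have hαk : α + k ≠ 0 := fun h => hα (-k) (by push_cast; linarith)
    have : α * (α + k) * L = 0 := by linarith
    exact (mul_eq_zero.1 this).resolve_left (mul_ne_zero hα0 hαk)
  rw [hL0] at hL
  have hgc : ContinuousOn g (Ioo 0 1) := fun r hr => (hg r hr).continuousAt.continuousWithinAt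
  have hEq : ∀ r ∈ Ioo (0 : ℝ) 1, extendFrom (Ioo 0 1) g r = g r := fun r hr =>
    extendFrom_extends hgc r hr
  have hEv : ∀ r ∈ Ioo (0 : ℝ) 1, extendFrom (Ioo 0 1) g =ᶠ[𝓝 r] g := fun r hr => by
    filter_upwards [isOpen_Ioo.mem_nhds hr] with s hs using hEq s hs
  intro r hr
  rw [← hEq r hr]
  refine radial_eq_zero_of_boundary_zero (k := k) (b := b) hα (fun s hs => ?_) (fun s hs => ?_)
    (continuousOn_Icc_extendFrom_Ioo hgc hg0 hL)
    (eq_lim_at_right_extendFrom_Ioo zero_lt_one hL) hb0 hb1 r hr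
  · rw [hEq s hs]
    exact (hg s hs).congr_of_eventuallyEq (hEv s hs)
  · rw [hEq s hs]
    exact hb s hs

/-! ### Fourier coefficients on circles and Wirtinger derivatives -/

/-- The unnormalized `k`-th Fourier coefficient of `V` on the circle of radius `r`. -/
noncomputable def angularMode (k : ℤ) (V : ℂ → ℂ) (r : ℝ) : ℂ :=
  ∫ θ in (0 : ℝ)..2 * Real.pi, Complex.exp (-(k * θ * Complex.I)) * V (circleMap 0 r θ)

theorem circleMap_mem_unitBall {r : ℝ} (hr : |r| < 1) (θ : ℝ) :
    circleMap 0 r θ ∈ ball (0 : ℂ) 1 := by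
  rwa [mem_ball_zero_iff, norm_circleMap_zero]

theorem norm_exp_neg_int_mul_I (k : ℤ) (θ : ℝ) :
    ‖Complex.exp (-(k * θ * Complex.I))‖ = 1 := by
  rw [show -((k : ℂ) * θ * Complex.I) = ((-(k * θ) : ℝ) : ℂ) * Complex.I by push_cast; ring]
  exact Complex.norm_exp_ofReal_mul_I _

theorem continuous_angularMode_integrand (k : ℤ) {V : ℂ → ℂ} (hV : ContinuousOn V (ball 0 1))
    {r : ℝ} (hr : |r| < 1) :
    Continuous fun θ : ℝ => Complex.exp (-(k * θ * Complex.I)) * V (circleMap 0 r θ) :=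
  Continuous.mul (by fun_prop)
    (hV.comp_continuous (continuous_circleMap 0 r) (circleMap_mem_unitBall hr))

/-- This is the radial derivative `r ∂_r` in Wirtinger form; the direction `z * I` below gives
`∂_θ`. -/
theorem fderiv_apply_self (V : ℂ → ℂ) (z : ℂ) :
    fderiv ℝ V z z = z * wirtingerDz V z + (starRingEnd ℂ) z * wirtingerDzbar V z := by
  have h : fderiv ℝ V z z = z.re * fderiv ℝ V z 1 + z.im * fderiv ℝ V z Complex.I := by
    conv_lhs => rw [← Complex.re_add_im z]
    rw [Complex.re_add_im, show fderiv ℝ V z z = fderiv ℝ V z (z.re • (1 : ℂ) + z.im • Complex.I) by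
      congr 1; simp [Complex.re_add_im]]
    rw [map_add, map_smul, map_smul, Complex.real_smul, Complex.real_smul]
  rw [h, wirtingerDz, wirtingerDzbar]
  have h1 := Complex.re_add_im z
  have h2 : (starRingEnd ℂ) z = z.re - z.im * Complex.I := by
    apply Complex.ext <;> simp
  rw [h2]
  conv_rhs => enter [1, 1]; rw [← h1]
  ring_nf
  rw [Complex.I_sq]
  ring

theorem fderiv_apply_self_mul_I (V : ℂ → ℂ) (z : ℂ) :
    fderiv ℝ V z (z * Complex.I) =
      Complex.I * (z * wirtingerDz V z - (starRingEnd ℂ) z * wirtingerDzbar V z) := by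
  have h : fderiv ℝ V z (z * Complex.I) =
      -z.im * fderiv ℝ V z 1 + z.re * fderiv ℝ V z Complex.I := by
    rw [show z * Complex.I = (-z.im) • (1 : ℂ) + z.re • Complex.I by
      apply Complex.ext <;> simp]
    rw [map_add, map_smul, map_smul, Complex.real_smul, Complex.real_smul]
    push_cast
    rfl
  rw [h, wirtingerDz, wirtingerDzbar]
  have h1 := Complex.re_add_im z
  have h2 : (starRingEnd ℂ) z = z.re - z.im * Complex.I := by
    apply Complex.ext <;> simp
  rw [h2]
  conv_rhs => enter [2, 1, 1]; rw [← h1]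
  ring_nf
  rw [Complex.I_sq]
  ring

section
variable {V : ℂ → ℂ} (hV : ContDiffOn ℝ 1 V (ball 0 1))
include hV

theorem continuousOn_wirtingerDz : ContinuousOn (wirtingerDz V) (ball 0 1) := by
  have h := hV.continuousOn_fderiv_of_isOpen isOpen_ball le_rfl
  exact ((h.clm_apply continuousOn_const).sub
    (continuousOn_const.mul (h.clm_apply continuousOn_const))).div_const _

theorem continuousOn_wirtingerDzbar : ContinuousOn (wirtingerDzbar V) (ball 0 1) := by
  have h := hV.continuousOn_fderiv_of_isOpen isOpen_ball le_rfl
  exact ((h.clm_apply continuousOn_const).add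
    (continuousOn_const.mul (h.clm_apply continuousOn_const))).div_const _

/-- Differentiation under the integral; a compact disc of radius between `|r|` and `1` supplies the
dominating constant. Allowing `r = 0` yields continuity of the modes at the centre. -/
theorem hasDerivAt_angularMode (k : ℤ) {r : ℝ} (hr : |r| < 1) :
    HasDerivAt (angularMode k V) (∫ θ in (0 : ℝ)..2 * Real.pi,
      Complex.exp (-(k * θ * Complex.I)) *
        fderiv ℝ V (circleMap 0 r θ) (Complex.exp (θ * Complex.I))) r := by
  have hfd := hV.continuousOn_fderiv_of_isOpen isOpen_ball le_rfl
  obtain ⟨ρ, hrρ, hρ⟩ := exists_between hr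
  obtain ⟨M, hM⟩ := (isCompact_closedBall (0 : ℂ) ρ).exists_bound_of_continuousOn
    (hfd.mono (closedBall_subset_ball hρ))
  have hs : {s : ℝ | |s| < ρ} ∈ 𝓝 r := (isOpen_lt continuous_abs continuous_const).mem_nhds hrρ
  have hcF := fun {s : ℝ} (hs : |s| < 1) => continuous_angularMode_integrand k hV.continuousOn hs
  refine (intervalIntegral.hasDerivAt_integral_of_dominated_loc_of_deriv_le
    (F := fun s θ => Complex.exp (-(k * θ * Complex.I)) * V (circleMap 0 s θ))
    (F' := fun s θ => Complex.exp (-(k * θ * Complex.I)) *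
        fderiv ℝ V (circleMap 0 s θ) (Complex.exp (θ * Complex.I)))
    (bound := fun _ => M) hs ?_ ((hcF hr).intervalIntegrable _ _) ?_ ?_ (by simp) ?_).2
  · filter_upwards [hs] with s hs'
    exact (hcF (hs'.trans hρ)).aestronglyMeasurable
  · refine Continuous.aestronglyMeasurable (Continuous.mul (by fun_prop) ?_)
    exact (hfd.comp_continuous (continuous_circleMap 0 r) (circleMap_mem_unitBall hr)).clm_apply
      (by fun_prop)
  · refine ae_of_all _ fun θ _ s hs' => ?_
    rw [norm_mul, norm_exp_neg_int_mul_I, one_mul]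
    refine (ContinuousLinearMap.le_opNorm _ _).trans ?_
    rw [Complex.norm_exp_ofReal_mul_I, mul_one]
    refine hM _ ?_
    rw [mem_closedBall_zero_iff, norm_circleMap_zero]
    exact le_of_lt hs'
  · refine ae_of_all _ fun θ _ s hs' => ?_
    have hd : HasFDerivAt V (fderiv ℝ V (circleMap 0 s θ)) (circleMap 0 s θ) :=
      ((hV.differentiableOn one_ne_zero).differentiableAt (isOpen_ball.mem_nhds
        (circleMap_mem_unitBall (lt_trans hs' hρ) θ))).hasFDerivAt
    have hc : HasDerivAt (fun s : ℝ => circleMap 0 s θ) (Complex.exp (θ * Complex.I)) s := by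
      simp only [circleMap_zero]
      simpa using (Complex.ofRealCLM.hasDerivAt (x := s)).mul_const (Complex.exp (θ * Complex.I))
    exact (hd.comp_hasDerivAt s hc).const_mul _

/-- Integration by parts in the angular variable. -/
theorem angularMode_mul_wirtingerDz (k : ℤ) {r : ℝ} (hr : |r| < 1) :
    angularMode k (fun z => z * wirtingerDz V z) r =
      angularMode k (fun z => (starRingEnd ℂ) z * wirtingerDzbar V z) r + k * angularMode k V r := by
  have hfd := hV.continuousOn_fderiv_of_isOpen isOpen_ball le_rfl
  have hcA := continuous_angularMode_integrand k
    (continuousOn_id.mul (continuousOn_wirtingerDz hV)) hr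
  have hcB := continuous_angularMode_integrand k
    (Complex.continuous_conj.continuousOn.mul (continuousOn_wirtingerDzbar hV)) hr
  have hcV := continuous_angularMode_integrand k hV.continuousOn hr
  have hder : ∀ θ ∈ uIcc 0 (2 * Real.pi), HasDerivAt
      (fun θ : ℝ => Complex.exp (-(k * θ * Complex.I)) * V (circleMap 0 r θ))
      (Complex.I * (Complex.exp (-(k * θ * Complex.I)) *
          (circleMap 0 r θ * wirtingerDz V (circleMap 0 r θ))
        - Complex.exp (-(k * θ * Complex.I)) *
          ((starRingEnd ℂ) (circleMap 0 r θ) * wirtingerDzbar V (circleMap 0 r θ))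
        - k * (Complex.exp (-(k * θ * Complex.I)) * V (circleMap 0 r θ)))) θ := by
    intro θ _
    have hd : HasFDerivAt V (fderiv ℝ V (circleMap 0 r θ)) (circleMap 0 r θ) :=
      ((hV.differentiableOn one_ne_zero).differentiableAt (isOpen_ball.mem_nhds
        (circleMap_mem_unitBall hr θ))).hasFDerivAt
    have h1 := hd.comp_hasDerivAt θ (hasDerivAt_circleMap 0 r θ)
    have h2 : HasDerivAt (fun θ : ℝ => Complex.exp (-(k * θ * Complex.I)))
        (Complex.exp (-(k * θ * Complex.I)) * (-(k * Complex.I))) θ := by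
      refine HasDerivAt.cexp ?_
      have h := (((Complex.ofRealCLM.hasDerivAt (x := θ)).const_mul (k : ℂ)).mul_const
        Complex.I).neg
      rw [Complex.ofRealCLM_apply, Complex.ofReal_one, mul_one] at h
      exact h
    refine (h2.mul h1).congr_deriv ?_
    rw [fderiv_apply_self_mul_I]
    simp only [Function.comp_apply]
    ring
  have hint := intervalIntegral.integral_eq_sub_of_hasDerivAt hder
    (Continuous.intervalIntegrable
      (continuous_const.mul ((hcA.sub hcB).sub (continuous_const.mul hcV))) _ _)
  have hper : Complex.exp (-(k * ((2 * Real.pi : ℝ) : ℂ) * Complex.I)) *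
        V (circleMap 0 r (2 * Real.pi))
      - Complex.exp (-(k * ((0 : ℝ) : ℂ) * Complex.I)) * V (circleMap 0 r 0) = 0 := by
    have h1 : circleMap 0 r (2 * Real.pi) = circleMap 0 r 0 := by
      simpa using periodic_circleMap 0 r 0
    have h2 : Complex.exp (-(k * ((2 * Real.pi : ℝ) : ℂ) * Complex.I)) = 1 := by
      rw [Complex.exp_eq_one_iff]
      exact ⟨-k, by push_cast; ring⟩
    rw [h1, h2]
    simp
  rw [hper, intervalIntegral.integral_const_mul] at hint
  have h0 := (mul_eq_zero.1 hint).resolve_left Complex.I_ne_zero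
  rw [← sub_eq_zero, ← sub_sub, ← h0, intervalIntegral.integral_sub, intervalIntegral.integral_sub,
    intervalIntegral.integral_const_mul]
  · rfl
  · exact hcA.intervalIntegrable _ _
  · exact hcB.intervalIntegrable _ _
  · exact (hcA.sub hcB).intervalIntegrable _ _
  · exact (continuous_const.mul hcV).intervalIntegrable _ _

theorem hasDerivAt_angularMode_wirtinger (k : ℤ) {r : ℝ} (hr : r ∈ Ioo (0 : ℝ) 1) :
    HasDerivAt (angularMode k V)
      ((angularMode k (fun z => z * wirtingerDz V z) r
        + angularMode k (fun z => (starRingEnd ℂ) z * wirtingerDzbar V z) r) / r) r := by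
  have hr' : |r| < 1 := by rw [abs_of_pos hr.1]; exact hr.2
  have hr0 : (r : ℂ) ≠ 0 := by exact_mod_cast hr.1.ne'
  refine (hasDerivAt_angularMode hV k hr').congr_deriv ?_
  rw [eq_div_iff hr0, angularMode, angularMode, ← intervalIntegral.integral_mul_const,
    ← intervalIntegral.integral_add]
  · refine intervalIntegral.integral_congr fun θ _ => ?_
    have h : (r : ℂ) * fderiv ℝ V (circleMap 0 r θ) (Complex.exp (θ * Complex.I))
        = fderiv ℝ V (circleMap 0 r θ) (circleMap 0 r θ) := by
      rw [← Complex.real_smul, ← map_smul, Complex.real_smul, ← circleMap_zero]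
    rw [← mul_add, ← fderiv_apply_self, ← h]
    ring
  · exact (continuous_angularMode_integrand k
      (continuousOn_id.mul (continuousOn_wirtingerDz hV)) hr').intervalIntegrable _ _
  · exact (continuous_angularMode_integrand k (Complex.continuous_conj.continuousOn.mul
      (continuousOn_wirtingerDzbar hV)) hr').intervalIntegrable _ _

end

/-! ### Hardy bounds and Fourier uniqueness -/

/-- The exponential weight has modulus `1`, so a mode is at most `2π` times the integral mean. The
majorized `W` leaves room for the factors `z` and `z̄`. -/
theorem exists_bound_angularMode {f : ℂ → ℂ} (hf : MemGeneralizedHardy 1 f) :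
    ∃ C, ∀ W : ℂ → ℂ, (∀ z ∈ ball (0 : ℂ) 1, ‖W z‖ ≤ ‖f z‖) → ∀ k : ℤ, ∀ r ∈ Ioo (0 : ℝ) 1,
      ‖angularMode k W r‖ ≤ C := by
  have hfin := hf.2.2.2
  rw [hardyNorm, if_neg ENNReal.one_ne_top] at hfin
  set K := ⨆ r ∈ Ioo (0 : ℝ) 1, hardyMean (1 : ℝ≥0∞).toReal r f with hK
  refine ⟨(ENNReal.ofReal (2 * Real.pi) * K).toReal, fun W hW k r hr => ?_⟩
  have hr' : |r| < 1 := by rw [abs_of_pos hr.1]; exact hr.2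
  have hmean : hardyMean (1 : ℝ≥0∞).toReal r f ≤ K := le_iSup₂_of_le r hr le_rfl
  simp only [hardyMean, ENNReal.toReal_one, ENNReal.rpow_one, div_one] at hmean
  have hpi : ENNReal.ofReal (2 * Real.pi) ≠ 0 := by
    simpa using Real.pi_pos
  rw [mul_comm, ← div_eq_mul_inv, ENNReal.div_le_iff_le_mul (Or.inl hpi)
    (Or.inl ENNReal.ofReal_ne_top), mul_comm K] at hmean
  rw [← toReal_enorm]
  refine ENNReal.toReal_mono (ENNReal.mul_ne_top ENNReal.ofReal_ne_top hfin.ne) ?_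
  refine le_trans ?_ hmean
  rw [angularMode, intervalIntegral.integral_of_le (by positivity)]
  refine (enorm_integral_le_lintegral_enorm _).trans (lintegral_mono fun θ => ?_)
  rw [enorm_le_iff_norm_le, norm_mul, norm_exp_neg_int_mul_I, one_mul]
  exact hW _ (circleMap_mem_unitBall hr' θ)

/-- A continuous function on the disc all of whose angular modes vanish is zero. -/
theorem eq_zero_of_angularMode_eq_zero {u : ℂ → ℂ} (hu : ContinuousOn u (ball 0 1))
    (h : ∀ k : ℤ, ∀ r ∈ Ioo (0 : ℝ) 1, angularMode k u r = 0) : ∀ z ∈ ball (0 : ℂ) 1, u z = 0 := by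
  have : Fact (0 < 2 * Real.pi) := ⟨by positivity⟩
  have hne : ∀ z ∈ ball (0 : ℂ) 1 \ {0}, u z = 0 := by
    rintro z ⟨hz, hz0⟩
    have hr : ‖z‖ ∈ Ioo (0 : ℝ) 1 := ⟨norm_pos_iff.2 hz0, mem_ball_zero_iff.1 hz⟩
    have hmem : ∀ t : AddCircle (2 * Real.pi),
        (‖z‖ : ℂ) * (AddCircle.toCircle t : ℂ) ∈ ball (0 : ℂ) 1 := by
      intro t
      rw [mem_ball_zero_iff, norm_mul, Circle.norm_coe, mul_one, Complex.norm_real, norm_norm]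
      exact hr.2
    let f : C(AddCircle (2 * Real.pi), ℂ) :=
      ⟨fun t => u ((‖z‖ : ℂ) * (AddCircle.toCircle t : ℂ)), hu.comp_continuous
        (continuous_const.mul (continuous_subtype_val.comp AddCircle.continuous_toCircle)) hmem⟩
    have hfe : ∀ θ : ℝ, f (θ : AddCircle (2 * Real.pi)) = u (circleMap 0 ‖z‖ θ) := by
      intro θ
      change u _ = _
      rw [AddCircle.toCircle_apply_mk, div_self (by positivity), one_mul, Circle.coe_exp,
        circleMap_zero]
    have hcoef : fourierCoeff f = 0 := by
      ext k
      rw [fourierCoeff_eq_intervalIntegral f k 0, zero_add, Pi.zero_apply]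
      have := h k _ hr
      rw [angularMode] at this
      refine smul_eq_zero_of_right _ (Eq.trans ?_ this)
      refine intervalIntegral.integral_congr fun θ _ => ?_
      rw [hfe, fourier_coe_apply, smul_eq_mul]
      congr 2
      have : (Real.pi : ℂ) ≠ 0 := by exact_mod_cast Real.pi_ne_zero
      push_cast
      field_simp
    -- Zero coefficients are summable, so the Fourier series converges pointwise to `f`, and its sum
    -- is `0`.
    have hs := has_pointwise_sum_fourier_series_of_summable (f := f)
      (by rw [hcoef]; exact summable_zero) (Complex.arg z : AddCircle (2 * Real.pi))
    rw [hcoef] at hs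
    simp only [Pi.zero_apply, zero_smul] at hs
    have := hs.unique hasSum_zero
    rw [hfe, circleMap_zero, Complex.norm_mul_exp_arg_mul_I] at this
    exact this
  intro z hz
  by_cases hz0 : z = 0
  · have hc : Tendsto u (𝓝[≠] 0) (𝓝 (u 0)) :=
      (hu.continuousAt (isOpen_ball.mem_nhds (mem_ball_self one_pos))).tendsto.mono_left
        nhdsWithin_le_nhds
    have hc' : Tendsto u (𝓝[≠] 0) (𝓝 0) := by
      refine tendsto_const_nhds.congr' ?_
      filter_upwards [self_mem_nhdsWithin,
        nhdsWithin_le_nhds (isOpen_ball.mem_nhds (mem_ball_self (x := (0 : ℂ)) one_pos))] with w h1 h2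
      exact (hne w ⟨h2, h1⟩).symm
    rw [hz0]
    exact tendsto_nhds_unique hc hc'
  · exact hne z ⟨hz, hz0⟩

/-! ### From the equation to the radial system -/

/-- For `β = -α` the equation is `(1-|z|²) ∂_z ∂_{z̄} u = -α (z ∂_z u - z̄ ∂_{z̄} u + α u)`. On the
`k`-th mode the first two terms in parentheses combine to `k`, which gives `-α(α+k)`. -/
theorem angularMode_eq_zero {α β : ℝ} {u : ℂ → ℂ} (hα : ∀ n : ℤ, α ≠ n) (hαβ : α + β = 0)
    (hu : IsAlphaBetaHarmonic α β u)
    (hH : MemGeneralizedHardy 1 (wirtingerDz u) ∨ MemGeneralizedHardy 1 (wirtingerDzbar u))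
    (k : ℤ) : ∀ r ∈ Ioo (0 : ℝ) 1, angularMode k u r = 0 := by
  obtain ⟨hu2, hpde⟩ := hu
  obtain rfl : β = -α := by linarith
  have hu1 : ContDiffOn ℝ 1 u (ball 0 1) := hu2.of_le (by norm_num)
  set v : ℂ → ℂ := fun z => (starRingEnd ℂ) z * wirtingerDzbar u z with hv
  have hfd : ContDiffOn ℝ 1 (fderiv ℝ u) (ball 0 1) :=
    hu2.fderiv_of_isOpen isOpen_ball (by norm_num)
  have hw1 : ContDiffOn ℝ 1 (wirtingerDzbar u) (ball 0 1) :=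
    ((hfd.clm_apply contDiffOn_const).add
      (contDiffOn_const.mul (hfd.clm_apply contDiffOn_const))).div_const _
  have hconj : ContDiff ℝ 1 (starRingEnd ℂ) := Complex.conjCLE.contDiff
  have hv1 : ContDiffOn ℝ 1 v (ball 0 1) := hconj.contDiffOn.mul hw1
  have habs : ∀ r ∈ Ioo (0 : ℝ) 1, |r| < 1 := fun r hr => by rw [abs_of_pos hr.1]; exact hr.2
  have hg : ∀ r ∈ Ioo (0 : ℝ) 1, HasDerivAt (angularMode k u)
      ((2 / r) • angularMode k v r + (k / r : ℝ) • angularMode k u r) r := by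
    intro r hr
    refine (hasDerivAt_angularMode_wirtinger hu1 k hr).congr_deriv ?_
    rw [angularMode_mul_wirtingerDz hu1 k (habs r hr)]
    simp only [Complex.real_smul]
    push_cast
    ring
  -- `∂_z` annihilates `z̄`, so `z ∂_z v = |z|² ∂_z ∂_{z̄} u`.
  have hdzv : ∀ z ∈ ball (0 : ℂ) 1, wirtingerDz v z =
      (starRingEnd ℂ) z * wirtingerDz (wirtingerDzbar u) z := by
    intro z hz
    have hd := (hw1.differentiableOn one_ne_zero).differentiableAt (isOpen_ball.mem_nhds hz)
    have hf : fderiv ℝ v z = _ :=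
      (HasFDerivAt.mul (Complex.conjCLE.toContinuousLinearMap.hasFDerivAt (x := z))
        hd.hasFDerivAt).fderiv
    rw [wirtingerDz, wirtingerDz, hf]
    simp
    ring_nf
    rw [Complex.I_sq]
    ring
  have hmodev : ∀ r ∈ Ioo (0 : ℝ) 1, angularMode k (fun z => z * wirtingerDz v z) r =
      (-(α * (α + k)) * r ^ 2 / (1 - r ^ 2) : ℝ) • angularMode k u r := by
    intro r hr
    have hr1 : (1 : ℂ) - (r : ℂ) ^ 2 ≠ 0 := by
      have : 1 - r ^ 2 ≠ 0 := by nlinarith [hr.1, hr.2]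
      exact_mod_cast this
    have hcA := continuous_angularMode_integrand k
      (continuousOn_id.mul (continuousOn_wirtingerDz hu1)) (habs r hr)
    have hcB := continuous_angularMode_integrand k hv1.continuousOn (habs r hr)
    have hcu := continuous_angularMode_integrand k hu1.continuousOn (habs r hr)
    -- The factor `1 - |z|²` is constant on the circle, so the equation can be solved for the mixed
    -- derivative and integrated.
    have hpt : angularMode k (fun z => z * wirtingerDz v z) r =
        (-(α * r ^ 2 / (1 - r ^ 2)) : ℂ) * (angularMode k (fun z => z * wirtingerDz u z) r
          - angularMode k v r + α * angularMode k u r) := by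
      simp only [angularMode]
      rw [← intervalIntegral.integral_const_mul (α : ℂ), ← intervalIntegral.integral_sub,
        ← intervalIntegral.integral_add, ← intervalIntegral.integral_const_mul]
      · refine intervalIntegral.integral_congr fun θ _ => ?_
        have hz := circleMap_mem_unitBall (habs r hr) θ
        have hn : (‖circleMap 0 r θ‖ : ℂ) = r := by
          rw [norm_circleMap_zero, abs_of_pos hr.1]
        have hzz : circleMap 0 r θ * (starRingEnd ℂ) (circleMap 0 r θ) = (r : ℂ) ^ 2 := by
          rw [Complex.mul_conj', hn]
        have hp := hpde _ hz
        rw [weightedLaplacian, hn] at hp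
        have hp' := (mul_eq_zero.1 hp).resolve_left hr1
        simp only [hv]
        rw [hdzv _ hz, ← mul_assoc (circleMap 0 r θ) (starRingEnd ℂ _), hzz]
        push_cast at hp'
        generalize wirtingerDz (wirtingerDzbar u) (circleMap 0 r θ) = X at *
        have hX : X = -(α / (1 - (r : ℂ) ^ 2)) * (circleMap 0 r θ * wirtingerDz u (circleMap 0 r θ)
            - (starRingEnd ℂ) (circleMap 0 r θ) * wirtingerDzbar u (circleMap 0 r θ)
            + α * u (circleMap 0 r θ)) := by
          field_simp
          linear_combination hp'
        rw [hX]
        ring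
      · exact (hcA.sub hcB).intervalIntegrable _ _
      · exact (continuous_const.mul hcu).intervalIntegrable _ _
      · exact hcA.intervalIntegrable _ _
      · exact hcB.intervalIntegrable _ _
    rw [hpt, angularMode_mul_wirtingerDz hu1 k (habs r hr), Complex.real_smul]
    push_cast
    simp only [hv]
    field_simp
    ring
  have hb : ∀ r ∈ Ioo (0 : ℝ) 1, HasDerivAt (angularMode k v)
      ((-k / r : ℝ) • angularMode k v r
        + (-(2 * (α * (α + k)) * r / (1 - r ^ 2)) : ℝ) • angularMode k u r) r := by
    intro r hr
    refine (hasDerivAt_angularMode_wirtinger hv1 k hr).congr_deriv ?_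
    have h1 := angularMode_mul_wirtingerDz hv1 k (habs r hr)
    rw [← sub_eq_iff_eq_add] at h1
    rw [← h1, hmodev r hr]
    have hr0 : (r : ℂ) ≠ 0 := by exact_mod_cast hr.1.ne'
    have hr1 : (1 : ℂ) - (r : ℂ) ^ 2 ≠ 0 := by
      have : 1 - r ^ 2 ≠ 0 := by nlinarith [hr.1, hr.2]
      exact_mod_cast this
    simp only [Complex.real_smul]
    push_cast
    field_simp
    ring
  have hlim0 : ∀ {V : ℂ → ℂ}, ContDiffOn ℝ 1 V (ball 0 1) →
      Tendsto (angularMode k V) (𝓝[>] 0) (𝓝 (angularMode k V 0)) := fun hV =>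
    (hasDerivAt_angularMode hV k (by simp)).continuousAt.tendsto.mono_left nhdsWithin_le_nhds
  have hv0 : angularMode k v 0 = 0 := by
    simp [angularMode, hv]
  obtain ⟨C, hC⟩ : ∃ C, (∀ r ∈ Ioo (0 : ℝ) 1,
      ‖angularMode k v r + (k : ℝ) • angularMode k u r‖ ≤ C) ∨
      ∀ r ∈ Ioo (0 : ℝ) 1, ‖angularMode k v r‖ ≤ C := by
    rcases hH with h | h
    · obtain ⟨C, hC⟩ := exists_bound_angularMode h
      refine ⟨C, Or.inl fun r hr => ?_⟩
      have := hC (fun z => z * wirtingerDz u z) (fun z hz => by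
        rw [norm_mul]
        exact mul_le_of_le_one_left (norm_nonneg _) (mem_ball_zero_iff.1 hz).le) k r hr
      rw [angularMode_mul_wirtingerDz hu1 k (habs r hr)] at this
      simpa [Complex.real_smul] using this
    · obtain ⟨C, hC⟩ := exists_bound_angularMode h
      refine ⟨C, Or.inr fun r hr => hC v (fun z hz => ?_) k r hr⟩
      simp only [hv]
      rw [norm_mul, RCLike.norm_conj]
      exact mul_le_of_le_one_left (norm_nonneg _) (mem_ball_zero_iff.1 hz).le
  -- The system has real coefficients, so every real functional of the modes solves the real system.
  have key : ∀ ℓ : ℂ →L[ℝ] ℝ, ∀ r ∈ Ioo (0 : ℝ) 1, ℓ (angularMode k u r) = 0 := by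
    intro ℓ
    refine radial_eq_zero_of_bounded (k := k) (b := fun r => ℓ (angularMode k v r))
      (C := ‖ℓ‖ * C) hα (fun r hr => ?_) (fun r hr => ?_)
      ((ℓ.continuous.tendsto _).comp (hlim0 hu1)) ?_ ?_
    · refine (ℓ.hasFDerivAt.comp_hasDerivAt r (hg r hr)).congr_deriv ?_
      rw [map_add, map_smul, map_smul, smul_eq_mul, smul_eq_mul]
      ring
    · refine (ℓ.hasFDerivAt.comp_hasDerivAt r (hb r hr)).congr_deriv ?_
      rw [map_add, map_smul, map_smul, smul_eq_mul, smul_eq_mul]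
      ring
    · have := (ℓ.continuous.tendsto _).comp (hlim0 hv1)
      rwa [hv0, map_zero] at this
    · refine hC.imp (fun h r hr => ?_) fun h r hr => ℓ.le_opNorm_of_le (h r hr)
      have := ℓ.le_opNorm_of_le (h r hr)
      rwa [map_add, map_smul, smul_eq_mul, Real.norm_eq_abs] at this
  intro r hr
  exact Complex.ext (key Complex.reCLM r hr) (key Complex.imCLM r hr)

theorem mainTheorem6 (α β : ℝ) (hα0 : α ≠ 0) (hβ0 : β ≠ 0)
    (hα : ∀ k : ℤ, k < 0 → α ≠ (k : ℝ)) (hβ : ∀ k : ℤ, k < 0 → β ≠ (k : ℝ))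
    (hαβ : α + β = 0) (u : ℂ → ℂ) (hu : IsAlphaBetaHarmonic α β u)
    (hH : MemGeneralizedHardy 1 (wirtingerDz u) ∨ MemGeneralizedHardy 1 (wirtingerDzbar u)) :
    ∀ z ∈ ball (0 : ℂ) 1, u z = 0 := by
  -- Positive integers are excluded through `β = -α`.
  have hint : ∀ n : ℤ, α ≠ n := by
    intro n hn
    rcases lt_trichotomy n 0 with h | h | h
    · exact hα n h hn
    · exact hα0 (by rw [hn, h, Int.cast_zero])
    · exact hβ (-n) (by omega) (by push_cast; linarith)
  exact eq_zero_of_angularMode_eq_zero hu.1.continuousOn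
    (angularMode_eq_zero hint hαβ hu hH)
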